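/- Let $\Bbbk$ be an algebraically closed field of characteristic zero, let $n\ge 0$ and $s\ge 1$ be integers, and let $R_2$ be the space of quadratic forms in $n+1$ variables over $\Bbbk$. Let $$\operatorname{Split}_2(\mathbb P^n)=\{[f]\in\mathbb P R_2=\mathbb P^{\binom{n+2}{2}-1} : f=\ell_1\ell_2\text{ for some linear forms }\ell_1,\ell_2\}.$$ For $X\subseteq\mathbb P^N$ let $\sigma_s(X)$, the $s$-th secant variety, be the Zariski closure of the union of the linear spans $\langle p_1,\dots,p_s\rangle$ with $p_1,\dots,p_s\in X$. Put $\operatorname{expdim}\sigma_s(X)=\min\{s(\dim X+1)-1,\,N\}$; call $\sigma_s(X)$ defective if $\dim\sigma_s(X)<\operatorname{expdim}\sigma_s(X)$, and let its defect be $\delta(\sigma_s(X))=\operatorname{expdim}\sigma_s(X)-\dim\sigma_s(X)$. Dimensions are Krull dimensions in the Zariski topology, and those of $\operatorname{Split}_2(\mathbb P^n)$ and $\sigma_s(\operatorname{Split}_2(\mathbb P^n))$ are finite. Then $\sigma_s(\operatorname{Split}_2(\mathbb P^n))$ is defective if and only if $2\le s\le\frac n2$. More precisely, $$\delta(\sigma_s(\operatorname{Split}_2(\mathbb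 P^n)))=\begin{cases}2s(s-1) & \text{if } s\le\frac{\binom{n+2}{2}}{2n+1},\\[1mm] \binom{n-2s+2}{2} & \text{if } \frac{\binom{n+2}{2}}{2n+1}\le s\le\frac n2,\\[1mm] 0 & \text{otherwise.}\end{cases}$$ -/

import Mathlib

open scoped LinearAlgebra.Projectivization

noncomputable section

namespace ProjVar

variable {k : Type*} [Field k] {V : Type*} [AddCommGroup V] [Module k V]

/-- The value at `v` of the polynomial function on `V` given by a polynomial `p` in linear
functionals on `V` (the variables are the elements of the dual space). If `V` has finite
dimension, these are the usual polynomial functions in the coordinates of a basis. -/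
def polyValue (p : MvPolynomial (Module.Dual k V) k) (v : V) : k :=
  MvPolynomial.eval (fun φ : Module.Dual k V => φ v) p

/-- The basic open set `D₊(p)` of the projective space of `V`, for a homogeneous `p`: for such
`p` the condition does not depend on the representative of the point. -/
def basicOpen (p : MvPolynomial (Module.Dual k V) k) : Set (ℙ k V) :=
  {x | polyValue p x.rep ≠ 0}

variable (k V) in
/-- The Zariski topology on the projective space of `V`: the closed sets are the sets of common
zeros of families of homogeneous polynomials. -/
@[reducible]
def zariski : TopologicalSpace (ℙ k V) :=
  TopologicalSpace.generateFrom
    {U | ∃ (m : ℕ) (p : MvPolynomial (Module.Dual k V) k), p.IsHomogeneous m ∧ U = basicOpen p}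

/-- The dimension of a subset of projective space: its Krull dimension (supremum of the lengths
of chains of irreducible closed subsets) in the Zariski topology. -/
def krullDim (X : Set (ℙ k V)) : WithBot ℕ∞ :=
  letI := zariski k V
  topologicalKrullDim X

/-- The dimension as an integer, `-1` for the empty set (meant for sets of finite dimension). -/
def dim (X : Set (ℙ k V)) : ℤ :=
  WithBot.recBotCoe (-1) (fun m : ℕ∞ => (m.toNat : ℤ)) (krullDim X)

/-- The `s`-th secant variety: the Zariski closure of the union of the linear spans of `s`
points of `X`. -/
def secantVariety (s : ℕ) (X : Set (ℙ k V)) : Set (ℙ k V) :=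
  letI := zariski k V
  closure (⋃ (p : Fin s → ℙ k V) (_ : ∀ i, p i ∈ X),
    (Projectivization.Subspace.span (Set.range p) : Set (ℙ k V)))

/-- The expected dimension `min {s (dim X + 1) - 1, N}` of the `s`-th secant variety of `X`,
where `N = dim V - 1` is the dimension of the ambient projective space. -/
def expDim (s : ℕ) (X : Set (ℙ k V)) : ℤ :=
  min ((s : ℤ) * (dim X + 1) - 1) ((Module.finrank k V : ℤ) - 1)

/-- The `s`-th secant variety of `X` is defective. -/
def IsDefective (s : ℕ) (X : Set (ℙ k V)) : Prop :=
  dim (secantVariety s X) < expDim s X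

/-- The defect of the `s`-th secant variety of `X`. -/
def defect (s : ℕ) (X : Set (ℙ k V)) : ℤ :=
  expDim s X - dim (secantVariety s X)

/-- A form is completely decomposable of degree `d` if it is a product of `d` linear forms. -/
def IsCompletelyDecomposable {σ : Type*} (d : ℕ) (f : MvPolynomial σ k) : Prop :=
  ∃ l : Fin d → MvPolynomial σ k, (∀ i, (l i).IsHomogeneous 1) ∧ f = ∏ i, l i

variable (k) in
/-- The space `R_d` of forms of degree `d` in `n + 1` variables over `k`. -/
abbrev Forms (d n : ℕ) : Submodule k (MvPolynomial (Fin (n + 1)) k) :=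
  MvPolynomial.homogeneousSubmodule (Fin (n + 1)) k d

variable (k) in
/-- The variety `Split_d(ℙⁿ)` of completely decomposable forms, in the projective space of the
space of forms of degree `d` in `n + 1` variables. -/
def split (d n : ℕ) : Set (ℙ k (Forms k d n)) :=
  {x | ∃ (f : Forms k d n) (hf : f ≠ 0),
    IsCompletelyDecomposable d (f : MvPolynomial (Fin (n + 1)) k) ∧
      x = Projectivization.mk k f hf}

end ProjVar

end

/-! Over an algebraically closed field of characteristic zero, sums of `s` products of two linear
forms are the same as sums of `2s` squares (`exists_sumSq_eq_sum`, `exists_sum_smul_eq_sumSq`), that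
is, forms with Gram matrix `LᵀL` for a `2s × (n+1)` matrix `L`. Householder reflections preserve
`LᵀL` and make a generic `L` upper triangular, so triangular matrices already parametrize a dense
subset (`mk_sumSq_mem_closure`). The dimension is the number of their entries minus one.

This count needs no tangent spaces. Upper bound (`krullDim_add_one_le`): a chain of irreducible
closed sets gives a chain of primes in the coordinate ring of the cone, and that ring embeds into
the polynomial ring in the parameters. Lower bound (`le_krullDim`): switching on the parameters one
at a time gives a flag of irreducible closed sets, each strict inclusion being detected by one
linear functional.

The rest is arithmetic: for `2s ≤ n` the defect is the minimum of `2s(s-1)` and `binom(n-2s+2, 2)`;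
for `2s > n` the secant variety has the dimension of the ambient space. -/

/-- The Krull dimension of a finitely generated algebra embedded into a polynomial ring is at most
the number of variables. -/
theorem ringKrullDim_le_card_of_injective {k B ι : Type*} [Field k] [CommRing B] [Algebra k B]
    [Algebra.FiniteType k B] [Finite ι] (f : B →ₐ[k] MvPolynomial ι k)
    (hf : Function.Injective f) : ringKrullDim B ≤ Nat.card ι := by
  have : Nontrivial B := f.toRingHom.domain_nontrivial
  -- Noether normalization: transcendence degree bounds `s`, and integrality makes contraction of
  -- primes strictly monotone.
  obtain ⟨s, g, hg, hint⟩ := exists_integral_inj_algHom_of_fg k B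
  have hs : s ≤ Nat.card ι := by
    have h := lift_trdeg_le_of_injective (f.comp g) (hf.comp hg)
    rw [MvPolynomial.trdeg_of_isDomain, MvPolynomial.trdeg_of_isDomain] at h
    have h' := Cardinal.toNat_le_toNat h (by simp [Cardinal.lift_lt_aleph0])
    rw [Cardinal.toNat_lift, Cardinal.toNat_lift, Cardinal.toNat_lift, Cardinal.mk_fin,
      Cardinal.toNat_natCast] at h'
    exact h'.trans_eq (Cardinal.toNat_lift _)
  algebraize [g.toRingHom]
  have h1 : ringKrullDim B ≤ ringKrullDim (MvPolynomial (Fin s) k) := by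
    refine Order.krullDim_le_of_strictMono
      (PrimeSpectrum.comap (algebraMap (MvPolynomial (Fin s) k) B)) fun p q hpq => ?_
    exact Ideal.IsIntegral.comap_lt_comap hpq
  rw [MvPolynomial.ringKrullDim_of_isNoetherianRing, ringKrullDim_eq_zero_of_field] at h1
  refine h1.trans ?_
  simpa using hs

theorem MvPolynomial.eval_aeval_eq {k σ τ : Type*} [CommSemiring k] (f : σ → MvPolynomial τ k)
    (u : τ → k) (p : MvPolynomial σ k) :
    MvPolynomial.eval u (MvPolynomial.aeval f p) =
      MvPolynomial.eval (fun i => MvPolynomial.eval u (f i)) p := by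
  induction p using MvPolynomial.induction_on with
  | C a => rw [MvPolynomial.algHom_C, MvPolynomial.algebraMap_eq, MvPolynomial.eval_C,
      MvPolynomial.eval_C]
  | add p q hp hq => simp only [map_add, hp, hq]
  | mul_X p i hp => simp only [map_mul, hp, MvPolynomial.aeval_X, MvPolynomial.eval_X]

/-! ### Zariski topology and ideals of affine cones -/

namespace ProjVar

variable {k : Type*} [Field k] {V : Type*} [AddCommGroup V] [Module k V]

attribute [local instance] zariski

theorem polyValue_smul {p : MvPolynomial (Module.Dual k V) k} {m : ℕ} (hp : p.IsHomogeneous m)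
    (c : k) (v : V) : polyValue p (c • v) = c ^ m * polyValue p v := by
  rw [polyValue, polyValue, MvPolynomial.eval_eq, MvPolynomial.eval_eq, Finset.mul_sum]
  refine Finset.sum_congr rfl fun d hd => ?_
  simp only [map_smul, smul_eq_mul, mul_pow, Finset.prod_mul_distrib, Finset.prod_pow_eq_pow_sum]
  rw [← hp.degree_eq_sum_deg_support hd]
  ring

theorem polyValue_mul (p q : MvPolynomial (Module.Dual k V) k) (v : V) :
    polyValue (p * q) v = polyValue p v * polyValue q v := by
  simp [polyValue]

theorem polyValue_rep_mk_ne_zero {p : MvPolynomial (Module.Dual k V) k} {m : ℕ}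
    (hp : p.IsHomogeneous m) {v : V} (hv : v ≠ 0) :
    polyValue p (Projectivization.mk k v hv).rep ≠ 0 ↔ polyValue p v ≠ 0 := by
  obtain ⟨a, ha⟩ := Projectivization.exists_smul_eq_mk_rep k v hv
  rw [← ha, Units.smul_def, polyValue_smul hp]
  simp

theorem isTopologicalBasis_basicOpen :
    TopologicalSpace.IsTopologicalBasis
      {U : Set (ℙ k V) | ∃ (m : ℕ) (p : MvPolynomial (Module.Dual k V) k),
        p.IsHomogeneous m ∧ U = basicOpen p} := by
  have h := TopologicalSpace.isTopologicalBasis_of_subbasis_of_inter (α := ℙ k V)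
    (r := {U : Set (ℙ k V) | ∃ (m : ℕ) (p : MvPolynomial (Module.Dual k V) k),
        p.IsHomogeneous m ∧ U = basicOpen p}) rfl ?_
  · rwa [Set.insert_eq_of_mem] at h
    exact ⟨0, 1, MvPolynomial.isHomogeneous_one _ _, by ext; simp [basicOpen, polyValue]⟩
  · rintro _ ⟨m, p, hp, rfl⟩ _ ⟨m', q, hq, rfl⟩
    exact ⟨m + m', p * q, hp.mul hq, by ext; simp [basicOpen, polyValue_mul]⟩

theorem isOpen_basicOpen {p : MvPolynomial (Module.Dual k V) k} {m : ℕ}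
    (hp : p.IsHomogeneous m) : IsOpen (basicOpen p : Set (ℙ k V)) :=
  isTopologicalBasis_basicOpen.isOpen ⟨m, p, hp, rfl⟩

theorem mem_closure_iff_polyValue {S : Set (ℙ k V)} {x : ℙ k V} :
    x ∈ closure S ↔ ∀ (m : ℕ) (p : MvPolynomial (Module.Dual k V) k), p.IsHomogeneous m →
      (∀ y ∈ S, polyValue p y.rep = 0) → polyValue p x.rep = 0 := by
  rw [isTopologicalBasis_basicOpen.mem_closure_iff]
  constructor
  · intro h m p hp hS
    by_contra hx
    obtain ⟨y, hy, hyS⟩ := h _ ⟨m, p, hp, rfl⟩ hx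
    exact hy (hS y hyS)
  · rintro h _ ⟨m, p, hp, rfl⟩ hx
    by_contra hne
    refine hx (h m p hp fun y hy => ?_)
    by_contra hy'
    exact hne ⟨y, hy', hy⟩

/-- A polynomial vanishing on a line through the origin has homogeneous components vanishing on
it. -/
theorem polyValue_homogeneousComponent_eq_zero [Infinite k]
    {p : MvPolynomial (Module.Dual k V) k} {v : V} (h : ∀ c : k, polyValue p (c • v) = 0) (d : ℕ) :
    polyValue (MvPolynomial.homogeneousComponent d p) v = 0 := by
  -- `q` is the polynomial `c ↦ p(c • v)`; its coefficients are the values of the components at `v`,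
  -- and it vanishes identically over an infinite field.
  set q : Polynomial k := ∑ i ∈ Finset.range (p.totalDegree + 1),
    Polynomial.monomial i (polyValue (MvPolynomial.homogeneousComponent i p) v) with hq
  have hq0 : q = 0 := by
    refine Polynomial.funext fun c => ?_
    rw [hq, Polynomial.eval_finsetSum, Polynomial.eval_zero, ← h c]
    conv_rhs => rw [← MvPolynomial.sum_homogeneousComponent p, polyValue, map_sum]
    refine Finset.sum_congr rfl fun i _ => ?_
    rw [Polynomial.eval_monomial, ← polyValue,
      polyValue_smul (MvPolynomial.homogeneousComponent_isHomogeneous i p), mul_comm]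
  by_cases hd : d < p.totalDegree + 1
  · have := congrArg (fun r => Polynomial.coeff r d) hq0
    simpa [hq, Polynomial.finsetSum_coeff, Polynomial.coeff_monomial, hd] using this
  · rw [MvPolynomial.homogeneousComponent_eq_zero _ _ (by omega)]
    simp [polyValue]

/-- The ideal of polynomials vanishing on the affine cone over a set of points. -/
def coneIdeal (Z : Set (ℙ k V)) : Ideal (MvPolynomial (Module.Dual k V) k) where
  carrier := {p | ∀ x ∈ Z, ∀ c : k, polyValue p (c • x.rep) = 0}
  add_mem' hp hq x hx c := by
    have := hp x hx c
    have := hq x hx c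
    simp_all [polyValue]
  zero_mem' x _ c := by simp [polyValue]
  smul_mem' r p hp x hx c := by
    rw [smul_eq_mul, polyValue_mul, hp x hx c, mul_zero]

theorem mem_coneIdeal_of_isHomogeneous {Z : Set (ℙ k V)} {p : MvPolynomial (Module.Dual k V) k}
    {m : ℕ} (hp : p.IsHomogeneous m) : p ∈ coneIdeal Z ↔ ∀ x ∈ Z, polyValue p x.rep = 0 := by
  refine ⟨fun h x hx => by simpa using h x hx 1, fun h x hx c => ?_⟩
  rw [polyValue_smul hp, h x hx, mul_zero]

theorem coneIdeal_anti {Z Z' : Set (ℙ k V)} (h : Z ⊆ Z') : coneIdeal Z' ≤ coneIdeal Z :=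
  fun _ hp x hx => hp x (h hx)

/-- Closed sets are cut out by homogeneous polynomials, so a closed set is recovered from its cone
ideal. This turns strict inclusions of closed sets into strict inclusions of ideals. -/
theorem subset_closure_of_coneIdeal_le {Z Z' : Set (ℙ k V)} (h : coneIdeal Z ≤ coneIdeal Z') :
    Z' ⊆ closure Z := fun x hx => mem_closure_iff_polyValue.2 fun _ _ hp hZ =>
  (mem_coneIdeal_of_isHomogeneous hp).1 (h ((mem_coneIdeal_of_isHomogeneous hp).2 hZ)) x hx

-- The ideal is homogeneous, so primality need only be tested on homogeneous `p`, `q`; if neither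
-- vanishes on `Z`, irreducibility gives a point of `Z` where both are nonzero.
attribute [local instance] MvPolynomial.gradedAlgebra in
theorem isPrime_coneIdeal [Infinite k] {Z : Set (ℙ k V)} (hZ : IsIrreducible Z) :
    (coneIdeal Z).IsPrime := by
  obtain ⟨⟨x, hx⟩, hirr⟩ := hZ
  have hhom : (coneIdeal Z).IsHomogeneous
      (MvPolynomial.homogeneousSubmodule (Module.Dual k V) k) := by
    intro d p hp
    have : ((DirectSum.decompose (MvPolynomial.homogeneousSubmodule (Module.Dual k V) k) p) d :
        MvPolynomial (Module.Dual k V) k) = MvPolynomial.homogeneousComponent d p :=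
      MvPolynomial.decomposition.decompose'_apply p d
    rw [this, mem_coneIdeal_of_isHomogeneous (MvPolynomial.homogeneousComponent_isHomogeneous d p)]
    exact fun x hx => polyValue_homogeneousComponent_eq_zero (hp x hx) d
  refine hhom.isPrime_of_homogeneous_mem_or_mem ?_ ?_
  · rw [Ideal.ne_top_iff_one]
    intro h
    simpa [polyValue] using h x hx 0
  · rintro p q ⟨m, hp⟩ ⟨m', hq⟩ hpq
    rw [mem_coneIdeal_of_isHomogeneous (hp.mul hq)] at hpq
    rw [mem_coneIdeal_of_isHomogeneous hp, mem_coneIdeal_of_isHomogeneous hq]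
    by_contra! hne
    obtain ⟨⟨y, hy, hpy⟩, z, hz, hqz⟩ := hne
    obtain ⟨w, hw, hpw, hqw⟩ := hirr _ _ (isOpen_basicOpen hp) (isOpen_basicOpen hq) ⟨y, hy, hpy⟩
      ⟨z, hz, hqz⟩
    have := hpq w hw
    rw [polyValue_mul] at this
    exact (mul_ne_zero hpw hqw) this

/-- The irrelevant ideal (the vertex of the cone) extends every chain of cone ideals by one step;
this is the `+ 1` between projective and affine dimension. -/
theorem coneIdeal_lt_ker_constantCoeff {Z : Set (ℙ k V)} (hZ : Z.Nonempty) :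
    coneIdeal Z < RingHom.ker (MvPolynomial.constantCoeff (σ := Module.Dual k V) (R := k)) := by
  obtain ⟨x, hx⟩ := hZ
  refine lt_of_le_of_ne (fun p hp => ?_) fun h => ?_
  · have := hp x hx 0
    simpa [polyValue, RingHom.mem_ker, MvPolynomial.constantCoeff_eq,
      MvPolynomial.eval_zero'] using this
  · obtain ⟨φ, hφ⟩ : ∃ φ : Module.Dual k V, φ x.rep ≠ 0 := by
      by_contra! h
      exact x.rep_nonzero ((Module.forall_dual_apply_eq_zero_iff k _).1 h)
    have : MvPolynomial.X φ ∈ coneIdeal Z := by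
      rw [h]; simp [RingHom.mem_ker]
    exact hφ (by simpa [polyValue] using this x hx 1)

/-! ### Dimension bounds for parametrized sets -/

/-- The points of projective space parametrized by a map. -/
def parametrized {T : Type*} (Φ : T → V) : Set (ℙ k V) :=
  {x | ∃ (t : T) (h : Φ t ≠ 0), x = Projectivization.mk k (Φ t) h}

theorem vanish_parametrized_iff {T : Type*} {Φ : T → V} {p : MvPolynomial (Module.Dual k V) k}
    {m : ℕ} (hp : p.IsHomogeneous m) :
    (∀ x ∈ parametrized (k := k) Φ, polyValue p x.rep = 0) ↔
      ∀ t, Φ t ≠ 0 → polyValue p (Φ t) = 0 := by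
  constructor
  · intro h t ht
    by_contra h'
    exact (polyValue_rep_mk_ne_zero hp ht).2 h' (h _ ⟨t, ht, rfl⟩)
  · rintro h _ ⟨t, ht, rfl⟩
    by_contra h'
    exact (polyValue_rep_mk_ne_zero hp ht).1 h' (h t ht)

section Parametrization

variable {ι : Type*} {Φ : (ι → k) → V} {P : Module.Dual k V → MvPolynomial ι k}

theorem eval_aeval_eq_polyValue (hP : ∀ φ u, MvPolynomial.eval u (P φ) = φ (Φ u))
    (p : MvPolynomial (Module.Dual k V) k) (u : ι → k) :
    MvPolynomial.eval u (MvPolynomial.aeval P p) = polyValue p (Φ u) := by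
  simp only [MvPolynomial.eval_aeval_eq, hP, polyValue]

/-- Kernel elements vanish on the image of `Φ`. The image is stable under scaling, so their
homogeneous components vanish there too, and homogeneous vanishing passes to the closure. -/
theorem ker_aeval_le_coneIdeal [Infinite k] (hP : ∀ φ u, MvPolynomial.eval u (P φ) = φ (Φ u))
    (hcone : ∀ (c : k) (u : ι → k), ∃ u', Φ u' = c • Φ u) {Z : Set (ℙ k V)}
    (hZ : Z ⊆ closure (parametrized Φ)) :
    RingHom.ker (MvPolynomial.aeval P : MvPolynomial (Module.Dual k V) k →ₐ[k] _) ≤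
      coneIdeal Z := by
  intro p hp x hx c
  rw [RingHom.mem_ker] at hp
  have key : ∀ d, polyValue (MvPolynomial.homogeneousComponent d p) x.rep = 0 := fun d => by
    have hd := MvPolynomial.homogeneousComponent_isHomogeneous d p
    refine mem_closure_iff_polyValue.1 (hZ hx) d _ hd ?_
    rw [vanish_parametrized_iff hd]
    refine fun u _ => polyValue_homogeneousComponent_eq_zero (fun c => ?_) d
    obtain ⟨u', hu'⟩ := hcone c u
    rw [← hu', ← eval_aeval_eq_polyValue hP, hp, map_zero]
  rw [← MvPolynomial.sum_homogeneousComponent p, polyValue, map_sum]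
  refine Finset.sum_eq_zero fun d _ => ?_
  rw [← polyValue, polyValue_smul (MvPolynomial.homogeneousComponent_isHomogeneous d p), key,
    mul_zero]

theorem ringKrullDim_quotient_ker_aeval_le [Infinite k] [Finite ι] [FiniteDimensional k V]
    (hP : ∀ φ u, MvPolynomial.eval u (P φ) = φ (Φ u)) :
    ringKrullDim (MvPolynomial (Module.Dual k V) k ⧸
      RingHom.ker (MvPolynomial.aeval P : MvPolynomial (Module.Dual k V) k →ₐ[k] _)) ≤
      Nat.card ι := by
  set J := RingHom.ker (MvPolynomial.aeval P : MvPolynomial (Module.Dual k V) k →ₐ[k] _) with hJ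
  have : Algebra.FiniteType k (MvPolynomial (Module.Dual k V) k ⧸ J) := by
    let b := Module.finBasis k (Module.Dual k V)
    let θ : MvPolynomial (Fin (Module.finrank k (Module.Dual k V))) k →ₐ[k]
      MvPolynomial (Module.Dual k V) k ⧸ J :=
      MvPolynomial.aeval fun i => Ideal.Quotient.mkₐ k J (MvPolynomial.X (b i))
    refine Algebra.FiniteType.of_surjective θ ?_
    -- The variables are all functionals, infinitely many of them; modulo `J` each is a combination
    -- of basis functionals, because linear relations between functionals hold at every `Φ u`.
    have hX : ∀ φ : Module.Dual k V, Ideal.Quotient.mkₐ k J (MvPolynomial.X φ) ∈ θ.range := by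
      intro φ
      refine ⟨∑ i, MvPolynomial.C (b.repr φ i) * MvPolynomial.X i, ?_⟩
      change θ _ = _
      have : θ (∑ i, MvPolynomial.C (b.repr φ i) * MvPolynomial.X i) = Ideal.Quotient.mkₐ k J
          (∑ i, MvPolynomial.C (b.repr φ i) * MvPolynomial.X (b i)) := by
        simp only [θ, map_sum, map_mul, MvPolynomial.aeval_X]
        simp [← MvPolynomial.algebraMap_eq]
      rw [this, Ideal.Quotient.mkₐ_eq_mk, Ideal.Quotient.eq, hJ, RingHom.mem_ker]
      refine MvPolynomial.funext fun u => ?_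
      change MvPolynomial.eval u (MvPolynomial.aeval P _) = _
      rw [eval_aeval_eq_polyValue hP]
      have hφ := congrArg (fun ψ : Module.Dual k V => ψ (Φ u)) (b.sum_repr φ)
      simp only [LinearMap.sum_apply, LinearMap.smul_apply, smul_eq_mul] at hφ
      simp [polyValue, hφ]
    rw [← AlgHom.range_eq_top, eq_top_iff]
    rintro x -
    obtain ⟨p, rfl⟩ := Ideal.Quotient.mkₐ_surjective k J x
    have hp : p ∈ Algebra.adjoin k (Set.range (MvPolynomial.X (R := k))) := by
      rw [MvPolynomial.adjoin_range_X]; trivial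
    have hle : Algebra.adjoin k (Set.range (MvPolynomial.X (R := k))) ≤
        θ.range.comap (Ideal.Quotient.mkₐ k J) :=
      Algebra.adjoin_le (by rintro _ ⟨φ, rfl⟩; exact hX φ)
    exact hle hp
  exact ringKrullDim_le_card_of_injective
    (Ideal.kerLiftAlg (MvPolynomial.aeval P : MvPolynomial (Module.Dual k V) k →ₐ[k] _))
    (Ideal.kerLiftAlg_injective _)

theorem krullDim_add_one_le [Infinite k] [Finite ι] [FiniteDimensional k V]
    (hP : ∀ φ u, MvPolynomial.eval u (P φ) = φ (Φ u))
    (hcone : ∀ (c : k) (u : ι → k), ∃ u', Φ u' = c • Φ u) {X : Set (ℙ k V)}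
    (hX : X ⊆ closure (parametrized Φ)) (hne : X.Nonempty) :
    krullDim X + 1 ≤ Nat.card ι := by
  refine le_trans ?_ (ringKrullDim_quotient_ker_aeval_le hP)
  set J := RingHom.ker (MvPolynomial.aeval P : MvPolynomial (Module.Dual k V) k →ₐ[k] _) with hJ
  have hne' : Nonempty (TopologicalSpace.IrreducibleCloseds X) := by
    obtain ⟨x, hx⟩ := hne
    exact ⟨closure {⟨x, hx⟩}, isIrreducible_singleton.closure, isClosed_closure⟩
  rw [ringKrullDim_quotient, krullDim, topologicalKrullDim, ← Order.krullDim_withBot,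
    ← Order.krullDim_orderDual (α := PrimeSpectrum.zeroLocus _)]
  have himage : ∀ Z : TopologicalSpace.IrreducibleCloseds X,
      IsIrreducible (Subtype.val '' (Z : Set X)) := fun Z =>
    Z.isIrreducible.image _ continuous_subtype_val.continuousOn
  have hJle : ∀ Z : Set X, J ≤ coneIdeal (Subtype.val '' Z) := fun Z =>
    ker_aeval_le_coneIdeal hP hcone (by rintro _ ⟨x, -, rfl⟩; exact hX x.2)
  let g : TopologicalSpace.IrreducibleCloseds X →
      PrimeSpectrum.zeroLocus (J : Set (MvPolynomial (Module.Dual k V) k)) := fun Z =>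
    ⟨⟨coneIdeal (Subtype.val '' (Z : Set X)), isPrime_coneIdeal (himage Z)⟩, hJle Z⟩
  let m : PrimeSpectrum.zeroLocus (J : Set (MvPolynomial (Module.Dual k V) k)) :=
    ⟨⟨RingHom.ker (MvPolynomial.constantCoeff (σ := Module.Dual k V) (R := k)),
      RingHom.ker_isPrime _⟩, (hJle _).trans
        (coneIdeal_lt_ker_constantCoeff (himage (Classical.arbitrary _)).nonempty).le⟩
  -- The adjoined bottom, which accounts for the `+ 1`, goes to the irrelevant ideal; the dual order
  -- appears because larger sets have smaller ideals.
  let f : WithBot (TopologicalSpace.IrreducibleCloseds X) →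
      (PrimeSpectrum.zeroLocus (J : Set (MvPolynomial (Module.Dual k V) k)))ᵒᵈ :=
    WithBot.recBotCoe (OrderDual.toDual m) fun Z => OrderDual.toDual (g Z)
  refine Order.krullDim_le_of_strictMono f (WithBot.strictMono_iff.2 ⟨fun Z Z' h => ?_, fun Z => ?_⟩)
  · change coneIdeal _ < coneIdeal _
    refine lt_of_le_not_ge (coneIdeal_anti (Set.image_mono h.le)) fun hle => h.not_ge fun x hx => ?_
    have hx' := subset_closure_of_coneIdeal_le hle ⟨x, hx, rfl⟩
    have := Topology.IsInducing.subtypeVal.closure_eq_preimage_closure_image (Z : Set X)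
    rw [Z.isClosed.closure_eq] at this
    change x ∈ (Z : Set X)
    rw [this]
    exact hx'
  · exact coneIdeal_lt_ker_constantCoeff (himage Z).nonempty

/-- Pulled back to the parameters, nonempty open sets are nonvanishing loci of nonzero polynomials,
whose product is nonzero. The extra factor `P φ` ensures that the common parameter has `Φ u ≠ 0` and
so defines a point. -/
theorem isIrreducible_parametrized [Infinite k]
    (hP : ∀ φ u, MvPolynomial.eval u (P φ) = φ (Φ u)) {u₀ : ι → k} (h₀ : Φ u₀ ≠ 0)
    {X : Set (ℙ k V)} (hX : parametrized Φ ⊆ X) :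
    IsIrreducible {x : X | x.1 ∈ parametrized Φ} := by
  refine ⟨⟨⟨_, hX ⟨u₀, h₀, rfl⟩⟩, u₀, h₀, rfl⟩, ?_⟩
  have key : ∀ U : Set X, IsOpen U → ({x : X | x.1 ∈ parametrized Φ} ∩ U).Nonempty →
      ∃ (m : ℕ) (p : MvPolynomial (Module.Dual k V) k), p.IsHomogeneous m ∧
        Subtype.val ⁻¹' basicOpen p ⊆ U ∧ MvPolynomial.aeval P p ≠ 0 := by
    rintro U hU ⟨⟨_, hx⟩, ⟨u, hu, rfl⟩, hxU⟩
    obtain ⟨U', hU', rfl⟩ := isOpen_induced_iff.1 hU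
    obtain ⟨_, ⟨m, p, hp, rfl⟩, hxp, hpU⟩ :=
      isTopologicalBasis_basicOpen.exists_subset_of_mem_open hxU hU'
    refine ⟨m, p, hp, Set.preimage_mono hpU, fun h => ?_⟩
    refine (polyValue_rep_mk_ne_zero hp hu).1 hxp ?_
    rw [← eval_aeval_eq_polyValue hP, h, map_zero]
  intro U₁ U₂ hU₁ hU₂ h₁ h₂
  obtain ⟨m, p, hp, hpU, hp0⟩ := key U₁ hU₁ h₁
  obtain ⟨m', q, hq, hqU, hq0⟩ := key U₂ hU₂ h₂
  obtain ⟨φ, hφ⟩ : ∃ φ : Module.Dual k V, φ (Φ u₀) ≠ 0 := by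
    by_contra! h
    exact h₀ ((Module.forall_dual_apply_eq_zero_iff k _).1 h)
  have hφ0 : P φ ≠ 0 := fun h => hφ (by rw [← hP, h, map_zero])
  obtain ⟨u, hu⟩ : ∃ u, MvPolynomial.eval u
      (MvPolynomial.aeval P p * MvPolynomial.aeval P q * P φ) ≠ 0 := by
    by_contra! h
    exact mul_ne_zero (mul_ne_zero hp0 hq0) hφ0 (MvPolynomial.funext fun u => by rw [h, map_zero])
  rw [map_mul, map_mul, eval_aeval_eq_polyValue hP, eval_aeval_eq_polyValue hP, hP] at hu
  have hu0 : Φ u ≠ 0 := fun h => by simp [h] at hu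
  refine ⟨⟨_, hX ⟨u, hu0, rfl⟩⟩, ⟨u, hu0, rfl⟩, hpU ?_, hqU ?_⟩
  · exact (polyValue_rep_mk_ne_zero hp hu0).2 fun h => by simp [h] at hu
  · exact (polyValue_rep_mk_ne_zero hq hu0).2 fun h => by simp [h] at hu

theorem le_krullDim [Infinite k] [Fintype ι] [LinearOrder ι] {D : ℕ} (hD : Fintype.card ι = D + 1)
    (hP : ∀ φ u, MvPolynomial.eval u (P φ) = φ (Φ u)) {X : Set (ℙ k V)}
    (hX : parametrized Φ ⊆ X) (F : ι → Module.Dual k V)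
    (hF₀ : ∀ i u, (∀ j, i ≤ j → u j = 0) → F i (Φ u) = 0)
    (hF₁ : ∀ i, ∃ u : ι → k, (∀ j, i < j → u j = 0) ∧ F i (Φ u) ≠ 0) :
    D ≤ krullDim X := by
  -- `r i` kills the parameters after `i`; the flag consists of the closures of the images of `Φ ∘ r
  -- i`.
  let r : ι → (ι → k) → ι → k := fun i u j => if j ≤ i then u j else 0
  have hr : ∀ i u, (∀ j, i < j → u j = 0) → r i u = u := fun i u hu => by
    ext j
    by_cases hj : j ≤ i
    · simp [r, hj]
    · simp [r, hj, hu j (not_le.1 hj)]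
  have hP' : ∀ i φ u, MvPolynomial.eval u (MvPolynomial.aeval
      (fun j => if j ≤ i then MvPolynomial.X j else 0) (P φ)) = φ ((Φ ∘ r i) u) := by
    intro i φ u
    rw [Function.comp_apply, ← hP, MvPolynomial.eval_aeval_eq]
    congr 2
    ext j
    by_cases hj : j ≤ i <;> simp [r, hj]
  have hsub : ∀ i, parametrized (k := k) (Φ ∘ r i) ⊆ X := by
    rintro i _ ⟨u, hu, rfl⟩
    exact hX ⟨r i u, hu, rfl⟩
  have hne : ∀ i, ∃ u, F i ((Φ ∘ r i) u) ≠ 0 := fun i => by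
    obtain ⟨u, hu, hF⟩ := hF₁ i
    exact ⟨u, by rwa [Function.comp_apply, hr i u hu]⟩
  have hirr : ∀ i, IsIrreducible {x : X | x.1 ∈ parametrized (Φ ∘ r i)} := fun i => by
    obtain ⟨u, hu⟩ := hne i
    exact isIrreducible_parametrized (hP' i) (u₀ := u) (fun h => hu (by rw [h, map_zero])) (hsub i)
  let C : ι → TopologicalSpace.IrreducibleCloseds X := fun i =>
    ⟨closure {x : X | x.1 ∈ parametrized (Φ ∘ r i)}, (hirr i).closure, isClosed_closure⟩
  have hC : StrictMono C := by
    intro i j hij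
    refine lt_of_le_not_ge (closure_mono ?_) fun hle => ?_
    · rintro ⟨_, hx⟩ ⟨u, hu, rfl⟩
      have : r j (r i u) = r i u := hr j _ fun l hl => by simp [r, not_le.2 (hij.trans hl)]
      exact ⟨r i u, by simpa [this] using hu, by simp [this]⟩
    -- The linear form `F j` vanishes on the image of `Φ ∘ r i` for `i < j`, but not on that of `Φ ∘
    -- r j`.
    · have hF : (MvPolynomial.X (F j) : MvPolynomial (Module.Dual k V) k).IsHomogeneous 1 :=
        MvPolynomial.isHomogeneous_X k _
      obtain ⟨u, hu⟩ := hne j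
      have hu0 : (Φ ∘ r j) u ≠ 0 := fun h => hu (by rw [h, map_zero])
      have hmem : (⟨_, hsub j ⟨u, hu0, rfl⟩⟩ : X) ∈
          closure {x : X | x.1 ∈ parametrized (Φ ∘ r i)} :=
        hle (subset_closure ⟨u, hu0, rfl⟩)
      obtain ⟨⟨_, hx⟩, hxF, ⟨w, hw, rfl⟩⟩ := mem_closure_iff.1 hmem _
        ((isOpen_basicOpen hF).preimage continuous_subtype_val)
        ((polyValue_rep_mk_ne_zero hF hu0).2 (by simpa [polyValue] using hu))
      have hxF' := (polyValue_rep_mk_ne_zero hF hw).1 hxF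
      refine hxF' ?_
      simpa [polyValue] using hF₀ j (r i w) fun l hl => by simp [r, not_le.2 (hij.trans_le hl)]
  let e := Fintype.orderIsoFinOfCardEq ι hD
  exact Order.le_krullDim_iff.2 ⟨LTSeries.mk D (C ∘ e) (hC.comp e.strictMono), rfl⟩

end Parametrization

end ProjVar

namespace ProjVar

attribute [local instance] zariski

variable {k : Type*} [Field k]

theorem krullDim_eq_of_parametrized [Infinite k] {V : Type*} [AddCommGroup V] [Module k V]
    [FiniteDimensional k V] {ι : Type*} [Fintype ι] [LinearOrder ι] {Φ : (ι → k) → V}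
    {P : Module.Dual k V → MvPolynomial ι k} {D : ℕ} (hD : Fintype.card ι = D + 1)
    (hP : ∀ φ u, MvPolynomial.eval u (P φ) = φ (Φ u))
    (hcone : ∀ (c : k) (u : ι → k), ∃ u', Φ u' = c • Φ u) {X : Set (ℙ k V)}
    (hX : parametrized Φ ⊆ X) (hX' : X ⊆ closure (parametrized Φ)) (F : ι → Module.Dual k V)
    (hF₀ : ∀ i u, (∀ j, i ≤ j → u j = 0) → F i (Φ u) = 0)
    (hF₁ : ∀ i, ∃ u : ι → k, (∀ j, i < j → u j = 0) ∧ F i (Φ u) ≠ 0) :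
    krullDim X = D := by
  refine le_antisymm ?_ (le_krullDim hD hP hX F hF₀ hF₁)
  have : Nonempty ι := Fintype.card_pos_iff.1 (by omega)
  have hne : X.Nonempty := by
    obtain ⟨u, -, hu⟩ := hF₁ (Classical.arbitrary ι)
    exact ⟨_, hX ⟨u, fun h => hu (by rw [h, map_zero]), rfl⟩⟩
  have h := krullDim_add_one_le hP hcone hX' hne
  rw [Nat.card_eq_fintype_card, hD] at h
  revert h
  induction krullDim X using WithBot.recBotCoe with
  | bot => simp
  | coe a =>
    induction a using ENat.recTopCoe with
    | top => intro h; exact absurd (top_le_iff.1 (WithBot.coe_le_coe.1 h)) (ENat.natCast_ne_top (D + 1))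
    | coe a => intro h; norm_cast at h ⊢; omega

/-! ### Quadratic forms as sums of squares -/

section Quadrics

variable {m n : ℕ}

variable (k) in
/-- The product of two variables as a quadratic form. -/
noncomputable def quadMonomial (j j' : Fin (n + 1)) : Forms k 2 n :=
  ⟨MvPolynomial.X j * MvPolynomial.X j',
    (MvPolynomial.isHomogeneous_X k j).mul (MvPolynomial.isHomogeneous_X k j')⟩

/-- The linear form with a given vector of coefficients. -/
noncomputable def linForm (a : Fin (n + 1) → k) : MvPolynomial (Fin (n + 1)) k :=
  ∑ j, MvPolynomial.C (a j) * MvPolynomial.X j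

/-- The sum of the squares of the linear forms given by the rows of a matrix. -/
noncomputable def sumSq (L : Fin m → Fin (n + 1) → k) : Forms k 2 n :=
  ∑ j, ∑ j', (∑ i, L i j * L i j') • quadMonomial k j j'

theorem isHomogeneous_linForm (a : Fin (n + 1) → k) : (linForm a).IsHomogeneous 1 :=
  MvPolynomial.IsHomogeneous.sum _ _ _ fun j _ => MvPolynomial.isHomogeneous_C_mul_X _ j

theorem exists_eq_linForm {l : MvPolynomial (Fin (n + 1)) k} (hl : l.IsHomogeneous 1) :
    ∃ a, l = linForm a := by
  have h : l ∈ MvPolynomial.homogeneousSubmodule (Fin (n + 1)) k 1 := hl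
  rw [MvPolynomial.homogeneousSubmodule_one_eq_span_X,
    Submodule.mem_span_range_iff_exists_fun] at h
  obtain ⟨a, rfl⟩ := h
  exact ⟨a, by simp [linForm, MvPolynomial.smul_eq_C_mul]⟩

theorem linForm_add (a b : Fin (n + 1) → k) : linForm (a + b) = linForm a + linForm b := by
  simp [linForm, add_mul, Finset.sum_add_distrib]

theorem linForm_smul (c : k) (a : Fin (n + 1) → k) :
    linForm (c • a) = MvPolynomial.C c * linForm a := by
  simp [linForm, Finset.mul_sum, mul_assoc]

theorem coe_sumSq (L : Fin m → Fin (n + 1) → k) :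
    (sumSq L : MvPolynomial (Fin (n + 1)) k) = ∑ i, linForm (L i) ^ 2 := by
  have h : ∀ i, linForm (L i) ^ 2 = ∑ j, ∑ j', MvPolynomial.C (L i j * L i j') *
      (MvPolynomial.X j * MvPolynomial.X j') := fun i => by
    rw [sq, linForm, Finset.sum_mul_sum]
    refine Finset.sum_congr rfl fun j _ => Finset.sum_congr rfl fun j' _ => ?_
    rw [MvPolynomial.C_mul]
    ring
  simp only [h]
  rw [Finset.sum_comm]
  simp only [sumSq, AddSubmonoidClass.coe_finsetSum, Submodule.coe_smul, quadMonomial]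
  refine Finset.sum_congr rfl fun j _ => ?_
  rw [Finset.sum_comm]
  refine Finset.sum_congr rfl fun j' _ => ?_
  rw [MvPolynomial.smul_eq_C_mul, map_sum, Finset.sum_mul]

theorem dual_sumSq (φ : Module.Dual k (Forms k 2 n)) (L : Fin m → Fin (n + 1) → k) :
    φ (sumSq L) = ∑ j, ∑ j', (∑ i, L i j * L i j') * φ (quadMonomial k j j') := by
  simp [sumSq]

/-- The polarization of quadratic forms at a pair of coordinate vectors. -/
noncomputable def polarCoeff (a b : Fin (n + 1)) : Module.Dual k (Forms k 2 n) :=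
  ((MvPolynomial.aeval (Pi.single a 1 + Pi.single b 1 : Fin (n + 1) → k)).toLinearMap -
    (MvPolynomial.aeval (Pi.single a 1 : Fin (n + 1) → k)).toLinearMap -
    (MvPolynomial.aeval (Pi.single b 1 : Fin (n + 1) → k)).toLinearMap).comp (Forms k 2 n).subtype

theorem polarCoeff_sumSq (a b : Fin (n + 1)) (L : Fin m → Fin (n + 1) → k) :
    polarCoeff a b (sumSq L) = 2 * ∑ i, L i a * L i b := by
  have h : ∀ (i : Fin m) (v : Fin (n + 1) → k),
      MvPolynomial.aeval v (linForm (L i)) = ∑ j, L i j * v j := fun i v => by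
    simp [linForm]
  simp only [polarCoeff, LinearMap.comp_apply, Submodule.subtype_apply, LinearMap.sub_apply,
    AlgHom.toLinearMap_apply, coe_sumSq, map_sum, map_pow, h, Pi.add_apply, mul_add,
    Finset.sum_add_distrib, Pi.single_apply, mul_ite, mul_one, mul_zero, Finset.sum_ite_eq',
    Finset.mem_univ, if_true, Finset.mul_sum]
  exact Finset.sum_congr rfl fun i _ => by ring

/-! ### Density of triangular matrices via Householder reflections -/

section Householder

theorem sumSq_eq_of_gram_eq {L L' : Fin m → Fin (n + 1) → k}
    (h : ∀ j j', ∑ i, L i j * L i j' = ∑ i, L' i j * L' i j') : sumSq L = sumSq L' := by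
  simp only [sumSq, h]

/-- The matrix `1 - 2wwᵀ/(wᵀw)` is orthogonal, so applying it to every column of `L` keeps the Gram
matrix `LᵀL`. -/
theorem sumSq_reflection (L : Fin m → Fin (n + 1) → k) (w : Fin m → k)
    (hw : ∑ i, w i * w i ≠ 0) :
    sumSq (fun i j => L i j - 2 / (∑ i, w i * w i) * (∑ i', w i' * L i' j) * w i) = sumSq L := by
  refine sumSq_eq_of_gram_eq fun j j' => ?_
  set N := ∑ i, w i * w i
  set s := fun j => ∑ i', w i' * L i' j with hs
  have h : ∀ i, (L i j - 2 / N * s j * w i) * (L i j' - 2 / N * s j' * w i) =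
      L i j * L i j' - 2 / N * s j' * (w i * L i j) - 2 / N * s j * (w i * L i j') +
      (2 / N) ^ 2 * s j * s j' * (w i * w i) := fun i => by ring
  change ∑ i, (L i j - 2 / N * s j * w i) * (L i j' - 2 / N * s j' * w i) = _
  simp only [h, Finset.sum_add_distrib, Finset.sum_sub_distrib, ← Finset.mul_sum]
  change _ - 2 / N * s j' * s j - 2 / N * s j * s j' + (2 / N) ^ 2 * s j * s j' * N = _
  field_simp
  ring

/-- The first `t` columns are upper triangular. -/
def IsTriangularUpTo (t : ℕ) (L : Fin m → Fin (n + 1) → k) : Prop :=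
  ∀ (i : Fin m) (j : Fin (n + 1)), (j : ℕ) < t → (j : ℕ) < i → L i j = 0

/-- With `v` the part of column `t` in rows `≥ t` and `α² = v·v`, reflection along `w = v - α e_t`
sends `v` to `α e_t`. Hypothesis `hv` says that `v` is not isotropic. -/
theorem exists_isTriangularUpTo_succ [IsAlgClosed k] [CharZero k] {t : ℕ}
    {L : Fin m → Fin (n + 1) → k} (hL : IsTriangularUpTo t L) (htm : t < m) (htn : t < n + 1)
    (hv : ∑ i : Fin m, (if t ≤ (i : ℕ) then L i ⟨t, htn⟩ ^ 2 else 0) ≠ 0) :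
    ∃ L' : Fin m → Fin (n + 1) → k, IsTriangularUpTo (t + 1) L' ∧ sumSq L' = sumSq L := by
  set v : Fin m → k := fun i => if t ≤ (i : ℕ) then L i ⟨t, htn⟩ else 0 with hvdef
  set T : Fin m := ⟨t, htm⟩ with hT
  set N := ∑ i, v i * v i with hN
  have hN0 : N ≠ 0 := by
    convert! hv using 2 with i
    simp only [hvdef]
    split_ifs <;> ring
  -- The sign of the root is chosen so that `w·w = 2α(α - v_t)` is nonzero.
  obtain ⟨α, hα, hαT⟩ : ∃ α : k, α * α = N ∧ α ≠ v T := by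
    obtain ⟨α, hα⟩ := IsAlgClosed.exists_pow_nat_eq N (n := 2) (by norm_num)
    by_cases h : α = v T
    · refine ⟨-α, by rw [← hα]; ring, fun h' => hN0 ?_⟩
      have : α = 0 := by linear_combination (1 / 2 : k) * (h - h')
      rw [← hα, this]; ring
    · exact ⟨α, by rw [← hα]; ring, h⟩
  set w : Fin m → k := fun i => v i - if i = T then α else 0 with hw
  have hwv : ∑ i, w i * v i = N - α * v T := by
    simp [hw, sub_mul, Finset.sum_sub_distrib, hN]
  have hww : ∑ i, w i * w i = 2 * (N - α * v T) := by
    have : ∀ i, w i * w i = w i * v i - if i = T then α * w T else 0 := fun i => by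
      by_cases h : i = T
      · subst h; simp [hw]; ring
      · simp [hw, h]
    simp only [this, Finset.sum_sub_distrib, hwv]
    simp [hw]
    linear_combination hα
  have hne : N - α * v T ≠ 0 := by
    have hα0 : α ≠ 0 := by rintro rfl; exact hN0 (by rw [← hα]; ring)
    rw [← hα, ← mul_sub]
    exact mul_ne_zero hα0 (sub_ne_zero.2 hαT)
  refine ⟨_, ?_, sumSq_reflection L w (by rw [hww]; exact mul_ne_zero two_ne_zero hne)⟩
  have hwlt : ∀ i : Fin m, (i : ℕ) < t → w i = 0 := fun i hi => by
    have : i ≠ T := fun h => by simp [h, hT] at hi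
    simp [hw, hvdef, this, not_le.2 hi]
  intro i j hj hij
  -- Earlier columns are orthogonal to `w`, which is supported in rows `≥ t` where they vanish, so
  -- they stay unchanged.
  rcases Nat.lt_succ_iff_lt_or_eq.1 hj with hj | hj
  · have : ∑ i', w i' * L i' j = 0 := Finset.sum_eq_zero fun i' _ => by
      by_cases hi' : (i' : ℕ) < t
      · rw [hwlt i' hi', zero_mul]
      · rw [hL i' j hj (by omega), mul_zero]
    simp only [this, hL i j hj hij]
    ring
  · have hj' : j = ⟨t, htn⟩ := Fin.ext hj
    have : ∑ i', w i' * L i' j = ∑ i', w i' * v i' := Finset.sum_congr rfl fun i' _ => by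
      by_cases hi' : (i' : ℕ) < t
      · rw [hwlt i' hi', zero_mul, zero_mul]
      · simp [hvdef, not_lt.1 hi', hj']
    have hiT : i ≠ T := fun h => by simp [h, hT, hj] at hij
    have hwi : w i = L i j := by
      simp [hw, hvdef, hiT, hj', show t ≤ (i : ℕ) by omega]
    simp only [this, hwv, hww, hwi]
    field_simp
    ring

theorem exists_polynomial_polyValue_sumSq (p : MvPolynomial (Module.Dual k (Forms k 2 n)) k)
    (L E : Fin m → Fin (n + 1) → k) :
    ∃ q : Polynomial k, ∀ ε, q.eval ε = polyValue p (sumSq (L + ε • E)) := by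
  let R : Module.Dual k (Forms k 2 n) → Polynomial k := fun φ =>
    ∑ j, ∑ j', (∑ i, (Polynomial.C (L i j) + Polynomial.X * Polynomial.C (E i j)) *
      (Polynomial.C (L i j') + Polynomial.X * Polynomial.C (E i j'))) *
        Polynomial.C (φ (quadMonomial k j j'))
  refine ⟨MvPolynomial.aeval R p, fun ε => ?_⟩
  have hR : ∀ φ, (R φ).eval ε = φ (sumSq (L + ε • E)) := fun φ => by
    simp [R, dual_sumSq, Polynomial.eval_finsetSum, mul_comm ε]
  rw [polyValue]
  induction p using MvPolynomial.induction_on with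
  | C a => simp
  | add p q hp hq => simp only [map_add, Polynomial.eval_add, hp, hq]
  | mul_X p φ hp => rw [map_mul, map_mul, Polynomial.eval_mul, hp, MvPolynomial.aeval_X, hR,
      MvPolynomial.eval_X]

/-- Columns are made triangular one by one. A Householder step can fail on an isotropic column, so
the entry at `(r, r)` is perturbed by `ε`: the obstruction `f` is a quadratic polynomial in `ε` with
leading coefficient 1, and `q`, the restriction of `p` to this line, vanishes wherever `f` does not.
Hence `q * f = 0`, so `q = 0`, and `ε = 0` gives the claim. -/
theorem polyValue_sumSq_eq_zero [IsAlgClosed k] [CharZero k]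
    {p : MvPolynomial (Module.Dual k (Forms k 2 n)) k}
    (hp : ∀ L : Fin m → Fin (n + 1) → k, IsTriangularUpTo (n + 1) L → polyValue p (sumSq L) = 0)
    (L : Fin m → Fin (n + 1) → k) : polyValue p (sumSq L) = 0 := by
  suffices h : ∀ t ≤ n + 1, ∀ L : Fin m → Fin (n + 1) → k, IsTriangularUpTo (n + 1 - t) L →
      polyValue p (sumSq L) = 0 from
    h (n + 1) le_rfl L fun i j hj => by omega
  intro t
  induction t with
  | zero => exact fun _ => hp
  | succ t ih =>
    intro ht L hL
    obtain ⟨r, hr⟩ : ∃ r, r = n + 1 - (t + 1) := ⟨_, rfl⟩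
    rw [← hr] at hL
    have ih := ih (by omega)
    rw [show n + 1 - t = r + 1 by omega] at ih
    have hrn : r < n + 1 := by omega
    by_cases hrm : r < m
    swap
    · exact ih L fun i j hj hij => hL i j (by omega) hij
    set T : Fin m := ⟨r, hrm⟩
    set C : Fin (n + 1) := ⟨r, hrn⟩
    let E : Fin m → Fin (n + 1) → k := fun i j => if i = T ∧ j = C then 1 else 0
    have hE : ∀ ε : k, IsTriangularUpTo r (L + ε • E) := fun ε i j hj hij => by
      have : j ≠ C := fun h => by simp [h, C] at hj
      simp [E, this, hL i j hj hij]
    obtain ⟨q, hq⟩ := exists_polynomial_polyValue_sumSq p L E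
    let f : Polynomial k := ∑ i : Fin m, if r ≤ (i : ℕ) then
      (Polynomial.C (L i C) + Polynomial.X * Polynomial.C (E i C)) ^ 2 else 0
    have hf : ∀ ε, f.eval ε = ∑ i : Fin m, if r ≤ (i : ℕ) then (L + ε • E) i C ^ 2 else 0 := by
      intro ε
      simp only [f, Polynomial.eval_finsetSum]
      refine Finset.sum_congr rfl fun i _ => ?_
      split_ifs <;> simp [mul_comm ε]
    have hf0 : f ≠ 0 := by
      have hcoeff : f.coeff 2 = 1 := by
        have : ∀ a e : k, ((Polynomial.C a + Polynomial.X * Polynomial.C e) ^ 2).coeff 2 = e ^ 2 :=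
          fun a e => by
            rw [show (Polynomial.C a + Polynomial.X * Polynomial.C e) ^ 2 = Polynomial.C (a ^ 2) +
              Polynomial.C (2 * a * e) * Polynomial.X + Polynomial.C (e ^ 2) * Polynomial.X ^ 2 by
                simp only [map_mul, map_pow, map_ofNat]; ring]
            rw [Polynomial.coeff_add, Polynomial.coeff_add, Polynomial.coeff_C_mul,
              Polynomial.coeff_C_mul, Polynomial.coeff_C, Polynomial.coeff_X, Polynomial.coeff_X_pow]
            simp
        rw [Polynomial.finsetSum_coeff, Finset.sum_eq_single T]
        · rw [if_pos le_rfl, this]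
          simp [E]
        · intro i _ hi
          split_ifs
          · rw [this]
            simp [E, hi]
          · rfl
        · simp
      intro h
      simp [h] at hcoeff
    have hqf : q * f = 0 := Polynomial.funext fun ε => by
      rw [Polynomial.eval_mul, Polynomial.eval_zero, hf]
      by_cases h : ∑ i : Fin m, (if r ≤ (i : ℕ) then (L + ε • E) i C ^ 2 else 0) = 0
      · rw [h, mul_zero]
      · obtain ⟨L', hL', hLL'⟩ := exists_isTriangularUpTo_succ (hE ε) hrm hrn h
        rw [hq, ← hLL', ih L' hL', zero_mul]
    have hq0 : q = 0 := (mul_eq_zero.1 hqf).resolve_right hf0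
    have := hq 0
    simpa [hq0] using this.symm

end Householder

end Quadrics

end ProjVar

namespace ProjVar

attribute [local instance] zariski

variable {k : Type*} [Field k] {m n s : ℕ}

/-! ### The triangular parametrization -/

/-- A position on or above the diagonal of a matrix. -/
@[ext]
structure TriangularIndex (m n : ℕ) where
  /-- The row. -/
  row : Fin m
  /-- The column. -/
  col : Fin (n + 1)
  row_le_col : (row : ℕ) ≤ col

namespace TriangularIndex

/-- The positions on or above the diagonal as pairs. -/
def equivSubtype (m n : ℕ) :
    {p : Fin m × Fin (n + 1) // (p.1 : ℕ) ≤ p.2} ≃ TriangularIndex m n where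
  toFun p := ⟨p.1.1, p.1.2, p.2⟩
  invFun p := ⟨(p.row, p.col), p.row_le_col⟩
  left_inv _ := rfl
  right_inv _ := rfl

instance : Fintype (TriangularIndex m n) := Fintype.ofEquiv _ (equivSubtype m n)

/-- The rows are ordered from the last to the first, the entries of a row from left to right. -/
instance : LinearOrder (TriangularIndex m n) :=
  LinearOrder.lift' (β := (Fin m)ᵒᵈ ×ₗ Fin (n + 1))
    (fun p => toLex (OrderDual.toDual p.row, p.col)) fun p q h => by
      have := toLex.injective h
      simp only [Prod.mk.injEq, OrderDual.toDual_inj] at this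
      exact TriangularIndex.ext this.1 this.2

theorem le_iff {p q : TriangularIndex m n} :
    p ≤ q ↔ q.row < p.row ∨ p.row = q.row ∧ p.col ≤ q.col := by
  change toLex (OrderDual.toDual p.row, p.col) ≤ toLex (OrderDual.toDual q.row, q.col) ↔ _
  rw [Prod.Lex.toLex_le_toLex]
  simp

/-- The diagonal position in the column whose number is the row of a given position. -/
def diagCol (p : TriangularIndex m n) : Fin (n + 1) := ⟨p.row, p.row_le_col.trans_lt p.col.2⟩

end TriangularIndex

/-- The upper triangular matrix with given entries. -/
def triangular {R : Type*} [Zero R] (u : TriangularIndex m n → R) (i : Fin m) (j : Fin (n + 1)) : R :=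
  if h : (i : ℕ) ≤ j then u ⟨i, j, h⟩ else 0

/-- The entries of `sumSq (triangular u)`, as polynomials in `u`. -/
noncomputable def triangularPoly (φ : Module.Dual k (Forms k 2 n)) :
    MvPolynomial (TriangularIndex m n) k :=
  ∑ j, ∑ j', (∑ i, triangular MvPolynomial.X i j * triangular MvPolynomial.X i j') *
    MvPolynomial.C (φ (quadMonomial k j j'))

theorem eval_triangularPoly (φ : Module.Dual k (Forms k 2 n)) (u : TriangularIndex m n → k) :
    MvPolynomial.eval u (triangularPoly φ) = φ (sumSq (triangular u)) := by
  have h : ∀ i j, MvPolynomial.eval u (triangular MvPolynomial.X i j) = triangular u i j := by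
    intro i j
    unfold triangular
    split_ifs <;> simp
  simp [triangularPoly, dual_sumSq, h]

theorem exists_sumSq_triangular_eq_smul [IsAlgClosed k] (c : k) (u : TriangularIndex m n → k) :
    ∃ u' : TriangularIndex m n → k, sumSq (triangular u') = c • sumSq (triangular u) := by
  obtain ⟨a, ha⟩ := IsAlgClosed.exists_pow_nat_eq c (n := 2) (by norm_num)
  refine ⟨a • u, ?_⟩
  have h : ∀ i j, triangular (a • u) i j = a * triangular u i j := fun i j => by
    unfold triangular
    split_ifs <;> simp
  simp only [sumSq, h, Finset.smul_sum, smul_smul, ← ha, Finset.mul_sum]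
  refine Finset.sum_congr rfl fun j _ => Finset.sum_congr rfl fun j' _ => ?_
  congr 1
  exact Finset.sum_congr rfl fun i _ => by ring

theorem mk_sumSq_mem_closure [IsAlgClosed k] [CharZero k] (L : Fin m → Fin (n + 1) → k)
    (hL : sumSq L ≠ 0) : Projectivization.mk k (sumSq L) hL ∈
      closure (parametrized fun u : TriangularIndex m n → k => sumSq (triangular u)) := by
  rw [mem_closure_iff_polyValue]
  intro d p hp h
  rw [vanish_parametrized_iff hp] at h
  by_contra hne
  obtain ⟨φ, hφ⟩ : ∃ φ : Module.Dual k (Forms k 2 n), φ (sumSq L) ≠ 0 := by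
    by_contra! h
    exact hL ((Module.forall_dual_apply_eq_zero_iff k _).1 h)
  -- The factor `X φ` forces vanishing at the zero form, where the hypothesis on `p` says nothing.
  have key := polyValue_sumSq_eq_zero (m := m) (p := p * MvPolynomial.X φ) (fun L' hL' => ?_) L
  · rw [polyValue_mul] at key
    refine mul_ne_zero ((polyValue_rep_mk_ne_zero hp hL).1 hne) ?_ key
    simpa [polyValue] using hφ
  · have hL'' : L' = triangular fun p => L' p.row p.col := by
      ext i j
      unfold triangular
      split_ifs with hij
      · rfl
      · exact hL' i j j.2 (not_le.1 hij)
    rw [polyValue_mul]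
    by_cases h0 : sumSq L' = 0
    · simp [h0, polyValue]
    · rw [hL''] at h0 ⊢
      rw [h _ h0, zero_mul]

/-- In `∑ i, L i a * L i b` with `a` the row of `p` and `b` its column, rows below `a` contribute
nothing by triangularity, rows above are switched off since they come later in the order, and row
`a` contributes a multiple of `u p = 0`. -/
theorem polarCoeff_sumSq_triangular_eq_zero (p : TriangularIndex m n)
    (u : TriangularIndex m n → k) (hu : ∀ q, p ≤ q → u q = 0) :
    polarCoeff p.diagCol p.col (sumSq (triangular u)) = 0 := by
  rw [polarCoeff_sumSq, Finset.sum_eq_zero, mul_zero]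
  intro i _
  unfold triangular
  rcases lt_trichotomy i p.row with h | h | h
  · split_ifs with h1 h2
    · rw [hu ⟨i, p.col, h2⟩ (TriangularIndex.le_iff.2 (Or.inl h)), mul_zero]
    all_goals simp
  · split_ifs with h1 h2
    · rw [hu ⟨i, p.col, h2⟩ (TriangularIndex.le_iff.2 (Or.inr ⟨h.symm, le_rfl⟩)), mul_zero]
    all_goals simp
  · rw [dif_neg (by simpa [TriangularIndex.diagCol] using h), zero_mul]

theorem exists_polarCoeff_sumSq_triangular_ne_zero [CharZero k] (p : TriangularIndex m n) :
    ∃ u : TriangularIndex m n → k, (∀ q, p < q → u q = 0) ∧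
      polarCoeff p.diagCol p.col (sumSq (triangular u)) ≠ 0 := by
  let d : TriangularIndex m n := ⟨p.row, p.diagCol, le_rfl⟩
  have hdp : d ≤ p := TriangularIndex.le_iff.2 (Or.inr ⟨rfl, p.row_le_col⟩)
  refine ⟨fun q => if q = p ∨ q = d then 1 else 0, fun q hq => if_neg ?_, ?_⟩
  · rintro (rfl | rfl)
    · exact lt_irrefl _ hq
    · exact hq.not_ge hdp
  · rw [polarCoeff_sumSq, Finset.sum_eq_single p.row]
    · have h1 : (p.row : ℕ) ≤ p.diagCol := le_rfl
      simp [triangular, p.row_le_col, h1, d]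
    · intro i _ hi
      have : ∀ h : (i : ℕ) ≤ p.diagCol, ¬ ((⟨i, p.diagCol, h⟩ : TriangularIndex m n) = p ∨
          (⟨i, p.diagCol, h⟩ : TriangularIndex m n) = d) := by
        rintro h (h' | h')
        · exact hi (congrArg TriangularIndex.row h')
        · exact hi (congrArg TriangularIndex.row h')
      refine mul_eq_zero_of_left ?_ _
      rw [triangular]
      split_ifs with h1 h2
      · exact absurd h2 (this h1)
      · rfl
      · rfl
    · simp

theorem krullDim_eq_of_sumSq [IsAlgClosed k] [CharZero k] {X : Set (ℙ k (Forms k 2 n))} {D : ℕ}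
    (hD : Fintype.card (TriangularIndex m n) = D + 1)
    (hX : ∀ (L : Fin m → Fin (n + 1) → k) (hL : sumSq L ≠ 0), Projectivization.mk k _ hL ∈ X)
    (hX' : X ⊆ closure
      (parametrized fun u : TriangularIndex m n → k => sumSq (triangular u))) :
    krullDim X = D := by
  have : FiniteDimensional k (Forms k 2 n) :=
    Module.Finite.iff_fg.2 (MvPolynomial.homogeneousSubmodule_fg _ _ _)
  have : Infinite k := IsAlgClosed.instInfinite
  refine krullDim_eq_of_parametrized hD eval_triangularPoly exists_sumSq_triangular_eq_smul ?_ hX'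
    (fun p => polarCoeff p.diagCol p.col)
    polarCoeff_sumSq_triangular_eq_zero exists_polarCoeff_sumSq_triangular_ne_zero
  rintro _ ⟨u, hu, rfl⟩
  exact hX _ hu

/-! ### Secants of the split variety as sums of squares -/

/-- A sum of `2s` squares of linear forms is a sum of `s` products of two linear forms. -/
theorem exists_sumSq_eq_sum [IsAlgClosed k] (L : Fin (s + s) → Fin (n + 1) → k) :
    ∃ f : Fin s → Forms k 2 n,
      (∀ i, IsCompletelyDecomposable 2 (f i : MvPolynomial (Fin (n + 1)) k)) ∧
        sumSq L = ∑ i, f i := by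
  obtain ⟨I, hI⟩ := IsAlgClosed.exists_pow_nat_eq (-1 : k) (n := 2) (by norm_num)
  -- `x² + y² = (x + Iy)(x - Iy)` with `I² = -1`.
  let l : Fin s → Fin (n + 1) → k := fun i => L (Fin.castAdd s i) + I • L (Fin.natAdd s i)
  let l' : Fin s → Fin (n + 1) → k := fun i => L (Fin.castAdd s i) + (-I) • L (Fin.natAdd s i)
  refine ⟨fun i => ⟨linForm (l i) * linForm (l' i),
    (isHomogeneous_linForm _).mul (isHomogeneous_linForm _)⟩, fun i =>
      ⟨![linForm (l i), linForm (l' i)], ?_, by simp [Fin.prod_univ_two]⟩, ?_⟩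
  · intro j
    fin_cases j
    · exact isHomogeneous_linForm _
    · exact isHomogeneous_linForm _
  · refine Subtype.ext ?_
    rw [coe_sumSq, Fin.sum_univ_add, ← Finset.sum_add_distrib, AddSubmonoidClass.coe_finsetSum]
    refine Finset.sum_congr rfl fun i _ => ?_
    have hC : (MvPolynomial.C I : MvPolynomial (Fin (n + 1)) k) ^ 2 = -1 := by
      rw [← map_pow, hI, map_neg, map_one]
    simp only [l, l', linForm_add, linForm_smul, map_neg]
    linear_combination (linForm (L (Fin.natAdd s i))) ^ 2 * hC

/-- A sum of `s` products of two linear forms is a sum of `2s` squares of linear forms. -/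
theorem exists_sum_smul_eq_sumSq [IsAlgClosed k] [CharZero k] (f : Fin s → Forms k 2 n)
    (hf : ∀ i, IsCompletelyDecomposable 2 (f i : MvPolynomial (Fin (n + 1)) k)) (c : Fin s → k) :
    ∃ L : Fin (s + s) → Fin (n + 1) → k, ∑ i, c i • f i = sumSq L := by
  obtain ⟨I, hI⟩ := IsAlgClosed.exists_pow_nat_eq (-1 : k) (n := 2) (by norm_num)
  have h : ∀ i, ∃ a b : Fin (n + 1) → k,
      (f i : MvPolynomial (Fin (n + 1)) k) = linForm a * linForm b := fun i => by
    obtain ⟨l, hl, hfl⟩ := hf i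
    obtain ⟨a, ha⟩ := exists_eq_linForm (hl 0)
    obtain ⟨b, hb⟩ := exists_eq_linForm (hl 1)
    exact ⟨a, b, by rw [hfl, Fin.prod_univ_two, ha, hb]⟩
  choose a b hab using h
  -- `c·ab = ((ca + b)/2)² + (I(ca - b)/2)²`.
  refine ⟨Fin.append (fun i => (2⁻¹ : k) • (c i • a i + b i))
    (fun i => (2⁻¹ * I : k) • (c i • a i + (-1 : k) • b i)), Subtype.ext ?_⟩
  rw [coe_sumSq, Fin.sum_univ_add, ← Finset.sum_add_distrib, AddSubmonoidClass.coe_finsetSum]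
  refine Finset.sum_congr rfl fun i _ => ?_
  have hC : (MvPolynomial.C I : MvPolynomial (Fin (n + 1)) k) ^ 2 = -1 := by
    rw [← map_pow, hI, map_neg, map_one]
  have h2 : (MvPolynomial.C (2⁻¹ : k) : MvPolynomial (Fin (n + 1)) k) * 2 = 1 := by
    rw [← map_ofNat (MvPolynomial.C (σ := Fin (n + 1)) (R := k)), ← map_mul,
      inv_mul_cancel₀ two_ne_zero, map_one]
  simp only [Fin.append_left, Fin.append_right, linForm_add, linForm_smul, map_neg, map_mul,
    map_one, Submodule.coe_smul, hab, MvPolynomial.smul_eq_C_mul]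
  generalize linForm (a i) = A
  generalize linForm (b i) = B
  generalize (MvPolynomial.C (c i) : MvPolynomial (Fin (n + 1)) k) = c' at *
  generalize (MvPolynomial.C (2⁻¹ : k) : MvPolynomial (Fin (n + 1)) k) = t at *
  generalize (MvPolynomial.C I : MvPolynomial (Fin (n + 1)) k) = J at *
  linear_combination -(t ^ 2 * (c' * A - B) ^ 2) * hC - (t * 2 + 1) * (c' * A * B) * h2

theorem mk_sum_mem_iUnion_span {f : Fin s → Forms k 2 n}
    (hf : ∀ i, IsCompletelyDecomposable 2 (f i : MvPolynomial (Fin (n + 1)) k))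
    (h0 : ∑ i, f i ≠ 0) : Projectivization.mk k (∑ i, f i) h0 ∈
      ⋃ (p : Fin s → ℙ k (Forms k 2 n)) (_ : ∀ i, p i ∈ split k 2 n),
        (Projectivization.Subspace.span (Set.range p) : Set (ℙ k (Forms k 2 n))) := by
  obtain ⟨i₀, -, hi₀⟩ := Finset.exists_ne_zero_of_sum_ne_zero h0
  classical
  -- Zero summands define no point, so they are replaced by the point of some nonzero summand.
  let p : Fin s → ℙ k (Forms k 2 n) := fun i =>
    if h : f i ≠ 0 then Projectivization.mk k (f i) h else Projectivization.mk k (f i₀) hi₀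
  have hp : ∀ i, p i ∈ split k 2 n := fun i => by
    simp only [p]
    split_ifs with h
    · exact ⟨f i, h, hf i, rfl⟩
    · exact ⟨f i₀, hi₀, hf i₀, rfl⟩
  refine Set.mem_iUnion₂.2 ⟨p, hp, ?_⟩
  rw [SetLike.mem_coe, ← Projectivization.Subspace.mem_submodule_iff]
  refine Submodule.sum_mem _ fun i _ => ?_
  by_cases h : f i = 0
  · rw [h]; exact Submodule.zero_mem _
  · rw [Projectivization.Subspace.mem_submodule_iff _ h]
    refine Projectivization.Subspace.subset_span _ ⟨i, ?_⟩
    simp [p, h]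

theorem iUnion_span_subset_closure [IsAlgClosed k] [CharZero k] :
    (⋃ (p : Fin s → ℙ k (Forms k 2 n)) (_ : ∀ i, p i ∈ split k 2 n),
      (Projectivization.Subspace.span (Set.range p) : Set (ℙ k (Forms k 2 n)))) ⊆
      closure (parametrized fun u : TriangularIndex (s + s) n → k => sumSq (triangular u)) := by
  intro x hx
  obtain ⟨p, hp, hx⟩ := Set.mem_iUnion₂.1 hx
  choose f hf0 hf hpf using hp
  have hle : Projectivization.Subspace.span (Set.range p) ≤
      (Submodule.span k (Set.range f)).projectivization := by
    rw [Projectivization.Subspace.span_le_subspace_iff]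
    rintro _ ⟨i, rfl⟩
    rw [hpf i, SetLike.mem_coe, Submodule.mk_mem_projectivization_iff]
    exact Submodule.subset_span ⟨i, rfl⟩
  have hx' := hle hx
  induction x with
  | h v hv =>
  rw [Submodule.mk_mem_projectivization_iff, Submodule.mem_span_range_iff_exists_fun] at hx'
  obtain ⟨c, rfl⟩ := hx'
  obtain ⟨L, hL⟩ := exists_sum_smul_eq_sumSq f hf c
  have hL0 : sumSq L ≠ 0 := hL ▸ hv
  have : Projectivization.mk k _ hv = Projectivization.mk k _ hL0 := by
    congr 1
  rw [this]
  exact mk_sumSq_mem_closure L hL0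

theorem krullDim_secantVariety_split [IsAlgClosed k] [CharZero k] {D : ℕ}
    (hD : Fintype.card (TriangularIndex (s + s) n) = D + 1) :
    krullDim (secantVariety s (split k 2 n)) = D := by
  refine krullDim_eq_of_sumSq hD (fun L hL => ?_)
    (closure_minimal iUnion_span_subset_closure isClosed_closure)
  obtain ⟨f, hf, hLf⟩ := exists_sumSq_eq_sum L
  have h0 : ∑ i, f i ≠ 0 := hLf ▸ hL
  have : Projectivization.mk k _ hL = Projectivization.mk k _ h0 := by congr 1
  rw [this]
  exact subset_closure (mk_sum_mem_iUnion_span hf h0)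

/-- This is the case of two squares. Closedness of the set is not needed: it is enough that it lies
between the parametrized set and its closure. -/
theorem krullDim_split [IsAlgClosed k] [CharZero k] {D : ℕ}
    (hD : Fintype.card (TriangularIndex (1 + 1) n) = D + 1) : krullDim (split k 2 n) = D := by
  refine krullDim_eq_of_sumSq hD (fun L hL => ?_) (fun x hx => iUnion_span_subset_closure (s := 1) <|
    Set.mem_iUnion₂.2 ⟨fun _ => x, fun _ => hx, Projectivization.Subspace.subset_span _ ⟨0, rfl⟩⟩)
  obtain ⟨f, hf, hLf⟩ := exists_sumSq_eq_sum (s := 1) L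
  rw [Fin.sum_univ_one] at hLf
  have h0 : f 0 ≠ 0 := hLf ▸ hL
  exact ⟨f 0, h0, hf 0, by congr 1⟩

/-! ### Parameter counts -/

theorem finrank_forms_two : Module.finrank k (Forms k 2 n) = (n + 2).choose 2 := by
  have e : Forms k 2 n ≃ₗ[k] ({d : Fin (n + 1) →₀ ℕ | d.degree = 2} →₀ k) :=
    (LinearEquiv.ofEq _ _ (MvPolynomial.homogeneousSubmodule_eq_finsupp_supported _ _ 2)).trans
      (AddMonoidAlgebra.supportedEquivFinsupp _)
  have e' : Sym (Fin (n + 1)) 2 ≃ {d : Fin (n + 1) →₀ ℕ | d.degree = 2} :=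
    Sym.equivNatSum (Fin (n + 1)) 2
  rw [(e.trans (Finsupp.domLCongr e'.symm)).finrank_eq, Module.finrank_finsupp_self,
    Sym.card_sym_eq_choose, Fintype.card_fin]
  rfl

theorem card_triangularIndex (m n : ℕ) :
    Fintype.card (TriangularIndex m n) = ∑ i ∈ Finset.range m, (n + 1 - i) := by
  rw [← Fintype.card_congr (TriangularIndex.equivSubtype m n), Fintype.card_subtype,
    Finset.card_filter, Fintype.sum_prod_type, Finset.sum_range]
  refine Finset.sum_congr rfl fun i _ => ?_
  rw [Fin.sum_univ_eq_sum_range (fun j => if (i : ℕ) ≤ j then 1 else 0)]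
  induction n + 1 with
  | zero => simp
  | succ N ih => rw [Finset.sum_range_succ, ih]; split_ifs <;> omega

theorem two_mul_card_triangularIndex (h : m ≤ n + 1) :
    2 * (Fintype.card (TriangularIndex m n) : ℤ) = m * (2 * n + 3 - m) := by
  rw [card_triangularIndex]
  induction m with
  | zero => simp
  | succ m ih =>
    rw [Finset.sum_range_succ, Nat.cast_add, mul_add, ih (by omega), Nat.cast_sub (by omega)]
    push_cast
    ring

/-- Rows beyond the `(n+1)`-st have no entry on or above the diagonal, so the count stabilizes at
the dimension of the space of quadratic forms. -/
theorem two_mul_card_triangularIndex_of_le (h : n + 1 ≤ m) :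
    2 * (Fintype.card (TriangularIndex m n) : ℤ) = (n + 1) * (n + 2) := by
  have h1 := two_mul_card_triangularIndex (le_refl (n + 1))
  have h2 : Fintype.card (TriangularIndex m n) = Fintype.card (TriangularIndex (n + 1) n) := by
    rw [card_triangularIndex, card_triangularIndex]
    refine (Finset.sum_subset (Finset.range_mono h) fun i _ hi => ?_).symm
    rw [Finset.mem_range] at hi
    omega
  rw [h2, h1]
  push_cast
  ring

theorem dim_eq_of_krullDim_eq {V : Type*} [AddCommGroup V] [Module k V] {X : Set (ℙ k V)} {D : ℕ}
    (h : krullDim X = D) : dim X = D := by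
  rw [dim, h]
  rfl

end ProjVar

theorem Int.two_mul_choose_add_two (n : ℕ) : 2 * ((n + 2).choose 2 : ℤ) = (n + 1) * (n + 2) := by
  induction n with
  | zero => rfl
  | succ n ih =>
    rw [show n + 1 + 2 = (n + 2) + 1 by ring, Nat.choose_succ_succ' (n + 2) 1, Nat.choose_one_right]
    push_cast
    linarith

/-! ### Computation of the defect -/

theorem proposition2p1p4 {k : Type*} [Field k] [IsAlgClosed k] [CharZero k]
    (n s : ℕ) (hs : 1 ≤ s) :
    ProjVar.krullDim (ProjVar.split k 2 n) ≠ ⊤ ∧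
    ProjVar.krullDim (ProjVar.secantVariety s (ProjVar.split k 2 n)) ≠ ⊤ ∧
    (ProjVar.IsDefective s (ProjVar.split k 2 n) ↔ 2 ≤ s ∧ (s : ℚ) ≤ (n : ℚ) / 2) ∧
    ((s : ℚ) ≤ ((n + 2).choose 2 : ℚ) / (2 * (n : ℚ) + 1) →
      ProjVar.defect s (ProjVar.split k 2 n) = 2 * (s : ℤ) * ((s : ℤ) - 1)) ∧
    (((n + 2).choose 2 : ℚ) / (2 * (n : ℚ) + 1) ≤ (s : ℚ) → (s : ℚ) ≤ (n : ℚ) / 2 →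
      ProjVar.defect s (ProjVar.split k 2 n) = ((n - 2 * s + 2).choose 2 : ℤ)) ∧
    (((n + 2).choose 2 : ℚ) / (2 * (n : ℚ) + 1) < (s : ℚ) → (n : ℚ) / 2 < (s : ℚ) →
      ProjVar.defect s (ProjVar.split k 2 n) = 0) := by
  have hcard : ∀ m : ℕ, 1 ≤ m → ∃ D : ℕ,
      Fintype.card (ProjVar.TriangularIndex m n) = D + 1 := fun m hm => by
    refine ⟨Fintype.card (ProjVar.TriangularIndex m n) - 1, ?_⟩
    have : 0 < Fintype.card (ProjVar.TriangularIndex m n) :=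
      Fintype.card_pos_iff.2 ⟨⟨⟨0, hm⟩, 0, le_rfl⟩⟩
    omega
  obtain ⟨D₁, hD₁⟩ := hcard (1 + 1) (by norm_num)
  obtain ⟨D, hD⟩ := hcard (s + s) (by omega)
  have hkX := ProjVar.krullDim_split (k := k) hD₁
  have hkS := ProjVar.krullDim_secantVariety_split (k := k) hD
  have htop : ∀ d : ℕ, (d : WithBot ℕ∞) ≠ ⊤ := fun d h =>
    ENat.natCast_ne_top d (WithBot.coe_injective h)
  have hdimX : (D₁ : ℤ) + 1 = 2 * n + 1 := by
    have h : (Fintype.card (ProjVar.TriangularIndex (1 + 1) n) : ℤ) = D₁ + 1 := by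
      exact_mod_cast hD₁
    rw [← h]
    rcases Nat.eq_zero_or_pos n with rfl | hn
    · have := ProjVar.two_mul_card_triangularIndex_of_le (m := 1 + 1) (n := 0) (by norm_num)
      push_cast at this ⊢
      linarith
    · have := ProjVar.two_mul_card_triangularIndex (m := 1 + 1) (n := n) (by omega)
      push_cast at this ⊢
      linarith
  have hC := Int.two_mul_choose_add_two n
  have hDcast : (Fintype.card (ProjVar.TriangularIndex (s + s) n) : ℤ) = D + 1 := by
    exact_mod_cast hD
  have hexp : ProjVar.expDim s (ProjVar.split k 2 n) =
      min ((s : ℤ) * (2 * n + 1)) ((n + 2).choose 2 : ℤ) - 1 := by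
    rw [ProjVar.expDim, ProjVar.dim_eq_of_krullDim_eq hkX, ProjVar.finrank_forms_two, hdimX,
      min_sub_sub_right]
  have hdef : ProjVar.defect s (ProjVar.split k 2 n) =
      min ((s : ℤ) * (2 * n + 1)) ((n + 2).choose 2 : ℤ) - (D + 1) := by
    rw [ProjVar.defect, ProjVar.dim_eq_of_krullDim_eq hkS, hexp]
    ring
  have hiff : ProjVar.IsDefective s (ProjVar.split k 2 n) ↔
      0 < ProjVar.defect s (ProjVar.split k 2 n) := by
    rw [ProjVar.IsDefective, ProjVar.defect, sub_pos]
  have hhalf : (s : ℚ) ≤ (n : ℚ) / 2 ↔ 2 * s ≤ n := by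
    rw [le_div_iff₀ two_pos, mul_comm]
    exact_mod_cast Iff.rfl
  have hpos : (0 : ℚ) < 2 * (n : ℚ) + 1 := by positivity
  have hle : (s : ℚ) ≤ ((n + 2).choose 2 : ℚ) / (2 * (n : ℚ) + 1) ↔
      (s : ℤ) * (2 * n + 1) ≤ ((n + 2).choose 2 : ℤ) := by
    rw [le_div_iff₀ hpos]
    exact_mod_cast Iff.rfl
  have hge : ((n + 2).choose 2 : ℚ) / (2 * (n : ℚ) + 1) ≤ (s : ℚ) ↔
      ((n + 2).choose 2 : ℤ) ≤ (s : ℤ) * (2 * n + 1) := by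
    rw [div_le_iff₀ hpos]
    exact_mod_cast Iff.rfl
  refine ⟨hkX ▸ htop D₁, hkS ▸ htop D, ?_⟩
  rcases le_or_gt (2 * s) n with hsn | hsn
  · obtain ⟨t, rfl⟩ := Nat.exists_eq_add_of_le hsn
    have hcardS := ProjVar.two_mul_card_triangularIndex (m := s + s) (n := 2 * s + t) (by omega)
    have hCt := Int.two_mul_choose_add_two t
    rw [hDcast] at hcardS
    -- The two candidates for the defect: the excess of the naive count `s(2n+1)` over the cone
    -- dimension `D + 1`, and the codimension of the secant variety, where `t = n - 2s`.
    have hA : (s : ℤ) * (2 * (2 * s + t : ℕ) + 1) - (D + 1) = 2 * s * (s - 1) := by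
      push_cast at hcardS ⊢
      linarith
    have hB : ((2 * s + t + 2).choose 2 : ℤ) - (D + 1) = ((t + 2).choose 2 : ℤ) := by
      push_cast at hcardS hC ⊢
      linarith
    have hmin : ProjVar.defect s (ProjVar.split k 2 (2 * s + t)) =
        min (2 * s * (s - 1) : ℤ) ((t + 2).choose 2 : ℤ) := by
      rw [hdef, ← hA, ← hB, min_sub_sub_right]
    have hchoose : (0 : ℤ) < ((t + 2).choose 2 : ℤ) := by
      exact_mod_cast Nat.choose_pos (by omega)
    rw [hiff, hhalf, hle, hge, hmin, show 2 * s + t - 2 * s + 2 = t + 2 by omega]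
    refine ⟨⟨fun h => ⟨?_, hsn⟩, fun h => lt_min ?_ hchoose⟩, fun h => min_eq_left (by linarith),
      fun h _ => min_eq_right (by linarith), fun _ h => absurd (hhalf.2 hsn) (not_le.2 h)⟩
    · have h1 := (lt_min_iff.1 h).1
      by_contra hs2
      obtain rfl : s = 1 := by omega
      simp at h1
    · have h2 : (2 : ℤ) ≤ s := by exact_mod_cast h.1
      have h3 : (0 : ℤ) < s - 1 := by linarith
      positivity
  · have hcardS := ProjVar.two_mul_card_triangularIndex_of_le (m := s + s) (n := n) (by omega)
    rw [hDcast] at hcardS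
    have hsn' : (n : ℤ) + 1 ≤ 2 * s := by exact_mod_cast hsn
    have hn : (0 : ℤ) ≤ n := by positivity
    have hmul : ((n : ℤ) + 1) * (2 * n + 1) ≤ 2 * (s * (2 * n + 1)) := by nlinarith
    have hnn : (n : ℤ) ≤ n * n := by exact_mod_cast Nat.le_mul_self n
    have hC' : ((n + 2).choose 2 : ℤ) ≤ s * (2 * n + 1) := by linarith
    have hzero : ProjVar.defect s (ProjVar.split k 2 n) = 0 := by
      rw [hdef, min_eq_right hC']
      linarith
    rw [hiff, hhalf, hle, hge, hzero]
    refine ⟨⟨fun h => absurd h (lt_irrefl _), fun h => by omega⟩, fun h => ?_,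
      fun _ h => by omega, fun _ _ => rfl⟩
    -- With `2s ≥ n + 1`, the first condition gives `(n+1)(2n+1) ≤ (n+1)(n+2)`, so only `n ≤ 1`, `s
    -- = 1` survives, and there `2s(s-1) = 0` as needed.
    have hn1 : n ≤ 1 := by
      have : (n : ℤ) * n ≤ 1 := by linarith
      have : (n : ℤ) ≤ 1 := by nlinarith
      exact_mod_cast this
    have hs1 : s = 1 := by
      interval_cases n
      · norm_num at h; omega
      · norm_num [Nat.choose] at h; omega
    simp [hs1]
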